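/- Let $\mathcal G$ be a family of finite simple graphs, and let $\mathcal C$ be a node coloring of $\mathcal G$, i.e. a map from $\bigsqcup_{G\in\mathcal G}V(G)$ to a set $\chi$ of colors, satisfying the degree assumption: for any nodes $u,v$ of (possibly different) graphs of $\mathcal G$, $\mathcal C(u)=\mathcal C(v)$ implies $\deg(u)=\deg(v)$. An edge filtration of $\mathcal G$ with respect to $\mathcal C$ is a positive, bounded real-valued function $ef^{\mathcal C}$ on the set of all colored edges, i.e. of all unordered pairs of colors $\{\{\mathcal C(u),\mathcal C(v)\}\}$ with $\{u,v\}\in E(G)$, $G\in\mathcal G$. For $G\in\mathcal G$, let $M(G)$ be the symmetric matrix indexed by $V(G)$ with $M(G)_{u,u}=0$, $M(G)_{u,v}=ef^{\mathcal C}(\{\{\mathcal C(u),\mathcal C(v)\}\})$ if $\{u,v\}\in E(G)$, and $M(G)_{u,v}=\infty$ if $u\ne v$ and $\{u,v\}\notin E(G)$. For $\varepsilon\in\mathbb R$, the Vietoris-Rips complex at scale $\varepsilon$ has as simplices the nonempty sets $\sigma\subseteq V(G)$ with $M(G)_{u,v}\le\varepsilon$ for all $u,v\in\sigma$. Let ${\rm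 ph}^i_{\rm VR}(G,ef^{\mathcal C})$ be the $i$-th persistence diagram (homology over $\mathbb Z/2\mathbb Z$) of the filtration, indexed by $\varepsilon\in\mathbb R$, by the $1$-skeleta of these complexes; it is a multiset of points $(b,d)$ with $b\in\mathbb R$ and $b<d\le\infty$. For an injective edge filtration, the topological edge diagram is the pair of multisets ${\rm TED}(G,ef^{\mathcal C})=({\rm ph}^0_{\rm VR}(G,ef^{\mathcal C}),{\rm ph}^1_{\rm VR}(G,ef^{\mathcal C}))$. Let $G,H\in\mathcal G$ be graphs with no isolated nodes. If the multisets of colors $\{\{\mathcal C(u)\mid u\in V(G)\}\}$ and $\{\{\mathcal C(v)\mid v\in V(H)\}\}$ are different, then for every injective edge filtration $ef^{\mathcal C}$, $${\rm TED}(G,ef^{\mathcal C})\neq{\rm TED}(H,ef^{\mathcal C}).$$ -/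

import Mathlib

/-! ## Simplicial homology with coefficients in the field with two elements -/

namespace TED

/-- The boundary operator in degree `n` on `ZMod 2`-linear combinations of finite sets of
vertices (given by their coefficient functions): a simplex of dimension `n ≥ 1` is sent to the
sum of its facets, and the boundary operator in degree `0` is zero. -/
noncomputable def boundary (P : Type*) [Fintype P] :
    ℕ → ((Finset P → ZMod 2) →ₗ[ZMod 2] (Finset P → ZMod 2))
  | 0 => 0
  | _ + 1 => by
      classical
      exact Fintype.linearCombination (ZMod 2)
        (fun σ : Finset P => ∑ v ∈ σ, Pi.single (σ.erase v) (1 : ZMod 2))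

section Homology

variable {P : Type*} [Fintype P]

/-- The `n`-chains of `K`: the space with basis the `n`-simplices of `K`, that is, the faces of
`K` with `n + 1` vertices. -/
def chains {P : Type*} (K : PreAbstractSimplicialComplex P) (n : ℕ) :
    Submodule (ZMod 2) (Finset P → ZMod 2) where
  carrier := {f | ∀ σ, f σ ≠ 0 → σ ∈ K.faces ∧ σ.card = n + 1}
  zero_mem' := fun _ h => absurd rfl h
  add_mem' := fun {f g} hf hg σ h => by
    by_cases hfσ : f σ = 0
    · exact hg σ fun hgσ => h (by simp [hfσ, hgσ])
    · exact hf σ hfσ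
  smul_mem' := fun c f hf σ h => hf σ fun hfσ => h (by simp [hfσ])

/-- The `n`-cycles of `K`. -/
noncomputable def cycles (K : PreAbstractSimplicialComplex P) (n : ℕ) :
    Submodule (ZMod 2) (Finset P → ZMod 2) :=
  chains K n ⊓ LinearMap.ker (boundary P n)

/-- The `n`-boundaries of `K`. -/
noncomputable def boundaries (K : PreAbstractSimplicialComplex P) (n : ℕ) :
    Submodule (ZMod 2) (Finset P → ZMod 2) :=
  (chains K (n + 1)).map (boundary P (n + 1))

theorem chains_mono {P : Type*} {K L : PreAbstractSimplicialComplex P} (h : K ≤ L) (n : ℕ) :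
    chains K n ≤ chains L n :=
  fun _ hf σ hσ => ⟨h (hf σ hσ).1, (hf σ hσ).2⟩

theorem cycles_mono {K L : PreAbstractSimplicialComplex P} (h : K ≤ L) (n : ℕ) :
    cycles K n ≤ cycles L n :=
  inf_le_inf_right _ (chains_mono h n)

theorem boundaries_mono {K L : PreAbstractSimplicialComplex P} (h : K ≤ L) (n : ℕ) :
    boundaries K n ≤ boundaries L n :=
  Submodule.map_mono (chains_mono h (n + 1))

/-- The `n`-th simplicial homology of `K` over `ZMod 2`: cycles modulo boundaries. -/
abbrev Homology (K : PreAbstractSimplicialComplex P) (n : ℕ) : Type _ :=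
  (cycles K n) ⧸ (boundaries K n).comap (cycles K n).subtype

/-- The map in homology induced by an inclusion of complexes. -/
noncomputable def homologyMap {K L : PreAbstractSimplicialComplex P} (h : K ≤ L) (n : ℕ) :
    Homology K n →ₗ[ZMod 2] Homology L n :=
  Submodule.mapQ _ _ (Submodule.inclusion (cycles_mono h n))
    (fun _ hx => boundaries_mono h n hx)

end Homology

/-! ## Persistence diagrams -/

section Persistence

variable {P : Type*} [Fintype P] (K : ℝ →o PreAbstractSimplicialComplex P) (n : ℕ)

/-- The classes at time `t` that come from a time strictly before `b` (for `b ≤ t`). -/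
noncomputable def olderThan (b t : ℝ) (hbt : b ≤ t) :
    Submodule (ZMod 2) (Homology (K t) n) :=
  ⨆ (s : ℝ) (hs : s < b),
    LinearMap.range (homologyMap (K.monotone (hs.le.trans hbt)) n)

/-- The classes at time `b` whose image at time `t` is the image of a class that already existed
before `b`. With `t = b` these are the classes not born at `b`; with `t > b` these are the classes
that are not born at `b` or that have died by time `t` (a class dies when it becomes
zero or merges with an older class). -/
noncomputable def goneBy (b t : ℝ) (hbt : b ≤ t) :
    Submodule (ZMod 2) (Homology (K b) n) :=
  (olderThan K n b t hbt).comap (homologyMap (K.monotone hbt) n)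

/-- The classes at time `b` that are gone at some time `t` with `b ≤ t < d`. -/
noncomputable def goneBefore (b : ℝ) (d : WithTop ℝ) :
    Submodule (ZMod 2) (Homology (K b) n) :=
  ⨆ (t : ℝ) (hbt : b ≤ t) (_ : (t : WithTop ℝ) < d), goneBy K n b t hbt

/-- The classes at time `b` that are gone at time `d` at the latest; for `d = ∞` all classes. -/
noncomputable def goneUpTo (b : ℝ) : WithTop ℝ → Submodule (ZMod 2) (Homology (K b) n)
  | ⊤ => ⊤
  | (d : ℝ) => ⨆ hbd : b ≤ d, goneBy K n b d hbd

open Classical in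
/-- The `n`-th persistence diagram of a filtration `K`, as a multiset of points `(b, d)` with
birth time `b` and death time `d > b`, where `d = ∞` is allowed. The multiset is given by its
multiplicity function: the multiplicity of `(b, d)` is the number of independent classes that are
born at `b` and die at `d`. -/
noncomputable def persistenceDiagram : ℝ × WithTop ℝ → ℕ := fun p =>
  if (p.1 : WithTop ℝ) < p.2 then
    Module.finrank (ZMod 2)
      (goneUpTo K n p.1 p.2 ⧸ (goneBefore K n p.1 p.2).comap (goneUpTo K n p.1 p.2).subtype)
  else 0

end Persistence

/-! ## The Vietoris-Rips filtration and its skeleta -/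

section VietorisRips

variable {P : Type*}

/-- The Vietoris-Rips complex at scale `ε` of the points `P` with distance matrix `M`, whose
entries may be infinite. -/
def vietorisRips (M : P → P → WithTop ℝ) (ε : ℝ) : PreAbstractSimplicialComplex P where
  faces := {σ | σ.Nonempty ∧ ∀ u ∈ σ, ∀ v ∈ σ, M u v ≤ (ε : WithTop ℝ)}
  isRelLowerSet_faces := fun _ hσ =>
    ⟨hσ.1, fun _ hτσ hτ => ⟨hτ, fun u hu v hv => hσ.2 u (hτσ hu) v (hτσ hv)⟩⟩

/-- The `k`-skeleton: all simplices of dimension at most `k`. -/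
def skeleton (K : PreAbstractSimplicialComplex P) (k : ℕ) : PreAbstractSimplicialComplex P where
  faces := {σ | σ ∈ K.faces ∧ σ.card ≤ k + 1}
  isRelLowerSet_faces := fun _ hσ =>
    ⟨(K.isRelLowerSet_faces hσ.1).1, fun _ hτσ hτ =>
      ⟨(K.isRelLowerSet_faces hσ.1).2 hτσ hτ, (Finset.card_le_card hτσ).trans hσ.2⟩⟩

/-- The filtration by the `k`-skeleta of the Vietoris-Rips complexes. -/
def ripsFiltration (M : P → P → WithTop ℝ) (k : ℕ) : ℝ →o PreAbstractSimplicialComplex P where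
  toFun ε := skeleton (vietorisRips M ε) k
  monotone' := fun _ _ h _ hσ =>
    ⟨⟨hσ.1.1, fun u hu v hv => (hσ.1.2 u hu v hv).trans (WithTop.coe_le_coe.mpr h)⟩, hσ.2⟩

end VietorisRips

/-! ## Node colorings, edge filtrations and topological edge diagrams -/

section Graphs

variable {ι : Type*} {V : ι → Type*} {χ : Type*}

/-- The degree assumption on a node coloring `C` of the family of graphs `𝒢`: nodes of the same
color, possibly in different graphs, have the same degree. -/
def DegreeAssumption (𝒢 : ∀ i, SimpleGraph (V i)) (C : ∀ i, V i → χ) : Prop :=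
  ∀ (i j : ι) (u : V i) (v : V j), C i u = C j v →
    ((𝒢 i).neighborSet u).ncard = ((𝒢 j).neighborSet v).ncard

/-- The multiset of the colors of the nodes of the graph with index `i`. -/
def colorMultiset [∀ i, Fintype (V i)] (C : ∀ i, V i → χ) (i : ι) : Multiset χ :=
  Finset.univ.val.map (C i)

/-- The colored edges that occur in the family: the unordered pairs of colors `{C u, C v}` for
`{u, v}` an edge of one of the graphs. -/
def coloredEdges (𝒢 : ∀ i, SimpleGraph (V i)) (C : ∀ i, V i → χ) : Set (Sym2 χ) :=
  ⋃ i, Sym2.map (C i) '' (𝒢 i).edgeSet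

theorem mem_coloredEdges {𝒢 : ∀ i, SimpleGraph (V i)} (C : ∀ i, V i → χ) {i : ι} {u v : V i}
    (h : (𝒢 i).Adj u v) : s(C i u, C i v) ∈ coloredEdges 𝒢 C :=
  Set.mem_iUnion.mpr ⟨i, s(u, v), h, rfl⟩

/-- An edge filtration of the family `𝒢` with respect to the node coloring `C`: a positive and
bounded real function on the colored edges. -/
structure EdgeFiltration (𝒢 : ∀ i, SimpleGraph (V i)) (C : ∀ i, V i → χ) where
  toFun : coloredEdges 𝒢 C → ℝ
  pos : ∀ x, 0 < toFun x
  bddAbove : BddAbove (Set.range toFun)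

variable {𝒢 : ∀ i, SimpleGraph (V i)} {C : ∀ i, V i → χ}

open Classical in
/-- The distance matrix of the graph with index `i`: zero on the diagonal, the value of the edge
filtration at the colored edge on adjacent nodes, and infinite otherwise. -/
noncomputable def distMatrix (ef : EdgeFiltration 𝒢 C) (i : ι) : V i → V i → WithTop ℝ :=
  fun u v =>
    if u = v then 0
    else if h : (𝒢 i).Adj u v then
      ((ef.toFun ⟨s(C i u, C i v), mem_coloredEdges C h⟩ : ℝ) : WithTop ℝ)
    else ⊤

/-- The `n`-th persistence diagram of the `1`-skeleton of the Vietoris-Rips filtration of the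
nodes of the graph with index `i`. -/
noncomputable def ph [∀ i, Fintype (V i)] (ef : EdgeFiltration 𝒢 C) (i : ι) (n : ℕ) : ℝ × WithTop ℝ → ℕ :=
  persistenceDiagram (ripsFiltration (distMatrix ef i) 1) n

/-- The topological edge diagram: the pair of the persistence diagrams in degrees `0` and `1`.
It is used for injective edge filtrations. -/
noncomputable def ted [∀ i, Fintype (V i)] (ef : EdgeFiltration 𝒢 C) (i : ι) :
    (ℝ × WithTop ℝ → ℕ) × (ℝ × WithTop ℝ → ℕ) :=
  (ph ef i 0, ph ef i 1)

end Graphs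

end TED

namespace TED

open Module

/-! ### Dimensions of subquotients -/

section Quotients

variable {k M : Type*} [Field k] [AddCommGroup M] [Module k M]

/-! The diagram pair determines how many edges have each length `r > 0`. An edge entering at `r`
either merges two components, giving a point `(0, r)` in degree 0, or closes a cycle, which in a
1-skeleton never dies and gives `(r, ∞)` in degree 1. In ranks, this is rank-nullity for the
boundary map on 1-chains, compared at `r` and just before `r`
(`two_mul_persistenceDiagram_add_persistenceDiagram`).

As the edge filtration is injective, lengths identify edge colors, so equal diagrams give equal
multisets of colored edges (`pairColors_eq_of_ted_eq`). These determine the degree sum over nodes of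
color `a`, which is their number times a common degree. That degree is positive without isolated
nodes, so it cancels (`colorMultiset_eq_of_pairColors_eq`). -/

theorem finrank_comap_subtype {A B : Submodule k M} (h : B ≤ A) :
    finrank k (B.comap A.subtype) = finrank k B :=
  (Submodule.comapSubtypeEquivOfLe h).finrank_eq

variable [FiniteDimensional k M]

theorem finrank_quotient_comap_subtype_add {A B : Submodule k M} (h : B ≤ A) :
    finrank k (A ⧸ B.comap A.subtype) + finrank k B = finrank k A := by
  rw [← finrank_comap_subtype h]
  exact Submodule.finrank_quotient_add_finrank _

/-- Rank-nullity for `N.mkQ` restricted to the preimage of `S`. -/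
theorem finrank_add_finrank_eq_finrank_comap_mkQ (N : Submodule k M) (S : Submodule k (M ⧸ N)) :
    finrank k S + finrank k N = finrank k (S.comap N.mkQ) := by
  have hN : N ≤ S.comap N.mkQ := by
    intro x hx
    simp [(Submodule.Quotient.mk_eq_zero N).2 hx]
  have h1 := LinearMap.finrank_range_add_finrank_ker (N.mkQ.domRestrict (S.comap N.mkQ))
  have h2 : LinearMap.range (N.mkQ.domRestrict (S.comap N.mkQ)) = S := by
    rw [LinearMap.range_domRestrict, Submodule.map_comap_eq_of_surjective N.mkQ_surjective]
  have h3 : LinearMap.ker (N.mkQ.domRestrict (S.comap N.mkQ)) =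
      N.comap (S.comap N.mkQ).subtype := by
    ext x
    simp [LinearMap.mem_ker]
  rw [h2, h3, finrank_comap_subtype hN] at h1
  exact h1

/-- The dimension of a quotient of two subspaces of `M ⧸ N`, computed in `M`. -/
theorem finrank_quotient_comap_subtype_add_comap_mkQ (N : Submodule k M)
    {S T : Submodule k (M ⧸ N)} (h : T ≤ S) :
    finrank k (S ⧸ T.comap S.subtype) + finrank k (T.comap N.mkQ) =
      finrank k (S.comap N.mkQ) := by
  rw [← finrank_add_finrank_eq_finrank_comap_mkQ, ← finrank_add_finrank_eq_finrank_comap_mkQ,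
    ← finrank_quotient_comap_subtype_add h, add_assoc]

end Quotients

/-! ### Chains, cycles and maps in homology -/

section Complexes

variable {P : Type*} [Fintype P]

theorem boundary_succ_apply (n : ℕ) [DecidableEq P] (f : Finset P → ZMod 2) :
    boundary P (n + 1) f = ∑ σ, f σ • ∑ v ∈ σ, Pi.single (σ.erase v) 1 := by
  simp only [boundary, Fintype.linearCombination_apply]
  congr!

theorem boundaries_le_chains (K : PreAbstractSimplicialComplex P) (n : ℕ) :
    boundaries K n ≤ chains K n := by
  classical
  rintro _ ⟨f, hf, rfl⟩
  rw [boundary_succ_apply]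
  refine Submodule.sum_mem _ fun σ _ => ?_
  by_cases h0 : f σ = 0
  · simp [h0]
  obtain ⟨hσ, hc⟩ := hf σ h0
  refine Submodule.smul_mem _ _ (Submodule.sum_mem _ fun v hv τ hτ => ?_)
  obtain rfl : τ = σ.erase v := by
    by_contra h
    exact hτ (by simp [h])
  have hc' : (σ.erase v).card = n + 1 := by rw [Finset.card_erase_of_mem hv, hc]; rfl
  refine ⟨(K.isRelLowerSet_faces hσ).2 (Finset.erase_subset v σ) ?_, hc'⟩
  exact Finset.card_pos.1 (by omega)

theorem cycles_zero (K : PreAbstractSimplicialComplex P) : cycles K 0 = chains K 0 := by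
  simp [cycles, boundary]

/-- The rank-nullity formula for the boundary operator. -/
theorem finrank_boundaries_add_finrank_cycles (K : PreAbstractSimplicialComplex P) (n : ℕ) :
    finrank (ZMod 2) (boundaries K n) + finrank (ZMod 2) (cycles K (n + 1)) =
      finrank (ZMod 2) (chains K (n + 1)) := by
  have h := LinearMap.finrank_range_add_finrank_ker
    ((boundary P (n + 1)).domRestrict (chains K (n + 1)))
  have hker : LinearMap.ker ((boundary P (n + 1)).domRestrict (chains K (n + 1))) =
      (cycles K (n + 1)).comap (chains K (n + 1)).subtype := by
    ext x
    simp [cycles]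
  have hle : cycles K (n + 1) ≤ chains K (n + 1) := inf_le_left
  rw [LinearMap.range_domRestrict, hker, finrank_comap_subtype hle] at h
  exact h

theorem finrank_chains (K : PreAbstractSimplicialComplex P) (n : ℕ) :
    finrank (ZMod 2) (chains K n) = Nat.card {σ // σ ∈ K.faces ∧ σ.card = n + 1} := by
  classical
  let e : chains K n ≃ₗ[ZMod 2] ({σ // σ ∈ K.faces ∧ σ.card = n + 1} → ZMod 2) :=
    { toFun := fun f σ => f.1 σ.1
      map_add' := fun _ _ => rfl
      map_smul' := fun _ _ => rfl
      invFun := fun g => ⟨fun σ => if h : σ ∈ K.faces ∧ σ.card = n + 1 then g ⟨σ, h⟩ else 0, by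
        intro σ hσ
        by_contra h
        exact hσ (dif_neg h)⟩
      left_inv := by
        intro f
        ext σ
        by_cases h : σ ∈ K.faces ∧ σ.card = n + 1
        · simp [h]
        · have : f.1 σ = 0 := by
            by_contra h0
            exact h (f.2 σ h0)
          simp [h, this]
      right_inv := by
        intro g
        ext σ
        simp [σ.2] }
  rw [e.finrank_eq, Module.finrank_fintype_fun_eq_card, Nat.card_eq_fintype_card]

theorem homologyMap_mkQ {K L : PreAbstractSimplicialComplex P} (h : K ≤ L) (n : ℕ)
    (z : cycles K n) :
    homologyMap h n (((boundaries K n).comap (cycles K n).subtype).mkQ z) =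
      ((boundaries L n).comap (cycles L n).subtype).mkQ ⟨z, cycles_mono h n z.2⟩ :=
  rfl

/-- A class dies in `L` exactly when its representing cycles bound there. -/
theorem comap_mkQ_ker_homologyMap {K L : PreAbstractSimplicialComplex P} (h : K ≤ L) (n : ℕ) :
    (LinearMap.ker (homologyMap h n)).comap
      ((boundaries K n).comap (cycles K n).subtype).mkQ =
      (boundaries L n).comap (cycles K n).subtype := by
  ext z
  rw [Submodule.mem_comap, LinearMap.mem_ker, homologyMap_mkQ, Submodule.mkQ_apply,
    Submodule.Quotient.mk_eq_zero]
  rfl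

theorem ker_homologyMap_mono {K L L' : PreAbstractSimplicialComplex P} (h : K ≤ L) (h' : K ≤ L')
    (hL : L ≤ L') (n : ℕ) :
    LinearMap.ker (homologyMap h n) ≤ LinearMap.ker (homologyMap h' n) := by
  intro x hx
  obtain ⟨z, rfl⟩ := Submodule.mkQ_surjective _ x
  rw [LinearMap.mem_ker, homologyMap_mkQ, Submodule.mkQ_apply,
    Submodule.Quotient.mk_eq_zero] at hx ⊢
  exact boundaries_mono hL n hx

theorem range_homologyMap_mono {K K' L : PreAbstractSimplicialComplex P} (h : K ≤ L) (h' : K' ≤ L)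
    (hK : K ≤ K') (n : ℕ) :
    LinearMap.range (homologyMap h n) ≤ LinearMap.range (homologyMap h' n) := by
  rintro _ ⟨x, rfl⟩
  obtain ⟨z, rfl⟩ := Submodule.mkQ_surjective _ x
  exact ⟨Submodule.mkQ _ ⟨z, cycles_mono hK n z.2⟩, rfl⟩

/-- Without boundaries each class of `L` has a single representative, so it comes from `K` only if
that very cycle lies in `K`. -/
theorem comap_mkQ_range_homologyMap {K L : PreAbstractSimplicialComplex P} (h : K ≤ L) {n : ℕ}
    (hL : boundaries L n = ⊥) :
    (LinearMap.range (homologyMap h n)).comap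
      ((boundaries L n).comap (cycles L n).subtype).mkQ =
      (cycles K n).comap (cycles L n).subtype := by
  ext z
  constructor
  · rintro ⟨x, hx⟩
    obtain ⟨w, rfl⟩ := Submodule.mkQ_surjective _ x
    rw [homologyMap_mkQ, Submodule.mkQ_apply, Submodule.mkQ_apply, Submodule.Quotient.eq,
      Submodule.mem_comap, hL, Submodule.mem_bot] at hx
    have : (w : Finset P → ZMod 2) = z := sub_eq_zero.1 hx
    rw [Submodule.mem_comap, Submodule.subtype_apply, ← this]
    exact w.2
  · intro hz
    exact ⟨Submodule.mkQ _ ⟨z, hz⟩, rfl⟩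

end Complexes

/-! ### Persistence multiplicities as growth of ranks -/

section Filtrations

variable {P : Type*} [Fintype P] (K : ℝ →o PreAbstractSimplicialComplex P)

/-- If the complexes are empty before time `b` and have the same vertices as `K b` afterwards, the
number of components born at `b` that die at `r` is the growth of the space of boundaries. -/
theorem persistenceDiagram_zero_add {b s r : ℝ} (hbs : b ≤ s) (hsr : s < r)
    (hs : ∀ t < r, K t ≤ K s) (hempty : ∀ t < b, (K t).faces = ∅)
    (hvert : chains (K r) 0 ≤ chains (K b) 0) :
    persistenceDiagram K 0 (b, (r : WithTop ℝ)) + finrank (ZMod 2) (boundaries (K s) 0) =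
      finrank (ZMod 2) (boundaries (K r) 0) := by
  have hbr : b ≤ r := hbs.trans hsr.le
  have hlt : (b : WithTop ℝ) < (r : WithTop ℝ) := WithTop.coe_lt_coe.2 (hbs.trans_lt hsr)
  have hold : ∀ t hbt, olderThan K 0 b t hbt = ⊥ := by
    intro t hbt
    refine le_bot_iff.1 (iSup₂_le fun u hu => ?_)
    rintro _ ⟨x, rfl⟩
    obtain ⟨z, rfl⟩ := Submodule.mkQ_surjective _ x
    have hz : z = 0 := by
      ext σ
      by_contra h0
      have := (z.2.1 σ h0).1
      simp [hempty u hu] at this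
    simp [hz]
  have hgone : ∀ t hbt, goneBy K 0 b t hbt = LinearMap.ker (homologyMap (K.monotone hbt) 0) := by
    intro t hbt
    rw [goneBy, hold, Submodule.comap_bot]
  have hup : goneUpTo K 0 b (r : WithTop ℝ) =
      LinearMap.ker (homologyMap (K.monotone hbr) 0) := by
    change (⨆ h : b ≤ r, goneBy K 0 b r h) = _
    rw [iSup_pos hbr, hgone]
  have hbefore : goneBefore K 0 b (r : WithTop ℝ) =
      LinearMap.ker (homologyMap (K.monotone hbs) 0) := by
    refine le_antisymm (iSup_le fun t => iSup₂_le fun hbt htr => ?_) ?_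
    · rw [hgone]
      exact ker_homologyMap_mono _ _ (hs t (WithTop.coe_lt_coe.1 htr)) 0
    · rw [← hgone s hbs]
      exact le_iSup_of_le s (le_iSup₂_of_le hbs (WithTop.coe_lt_coe.2 hsr) le_rfl)
  -- No vertex appears after `b`, so the boundary spaces at `s` and `r` can both be compared inside
  -- the cycles at `b`.
  have hle : ∀ t ≤ r, boundaries (K t) 0 ≤ cycles (K b) 0 := by
    intro t ht
    rw [cycles_zero]
    exact (boundaries_le_chains _ _).trans ((chains_mono (K.monotone ht) 0).trans hvert)
  have hsub : goneBefore K 0 b (r : WithTop ℝ) ≤ goneUpTo K 0 b (r : WithTop ℝ) := by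
    rw [hup, hbefore]
    exact ker_homologyMap_mono _ _ (K.monotone hsr.le) 0
  rw [persistenceDiagram, if_pos hlt, ← finrank_comap_subtype (hle s hsr.le),
    ← finrank_comap_subtype (hle r le_rfl), ← comap_mkQ_ker_homologyMap (K.monotone hbs),
    ← comap_mkQ_ker_homologyMap (K.monotone hbr), ← hup, ← hbefore]
  exact finrank_quotient_comap_subtype_add_comap_mkQ _ hsub

/-- If no `n`-cycle ever becomes a boundary, the number of classes born at `r` that persist
forever is the growth of the space of cycles. -/
theorem persistenceDiagram_top_add {n : ℕ} {s r : ℝ} (hsr : s < r) (hs : ∀ t < r, K t ≤ K s)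
    (hbd : ∀ t, boundaries (K t) n = ⊥) :
    persistenceDiagram K n (r, ⊤) + finrank (ZMod 2) (cycles (K s) n) =
      finrank (ZMod 2) (cycles (K r) n) := by
  have hold : ∀ t hrt, olderThan K n r t hrt =
      LinearMap.range (homologyMap (K.monotone (hsr.le.trans hrt)) n) := by
    intro t hrt
    refine le_antisymm (iSup₂_le fun u hu => range_homologyMap_mono _ _ (hs u hu) n) ?_
    exact le_iSup₂_of_le s hsr le_rfl
  -- Independent of `t`: the maps in homology are injective, so nothing born at `r` is ever lost.
  have hgone : ∀ t hrt, goneBy K n r t hrt =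
      LinearMap.range (homologyMap (K.monotone hsr.le) n) := by
    intro t hrt
    refine Submodule.comap_injective_of_surjective (Submodule.mkQ_surjective _) ?_
    rw [comap_mkQ_range_homologyMap _ (hbd r), goneBy, hold]
    ext z
    rw [Submodule.mem_comap, Submodule.mem_comap, homologyMap_mkQ, ← Submodule.mem_comap,
      comap_mkQ_range_homologyMap _ (hbd t)]
    rfl
  have hbefore : goneBefore K n r ⊤ = LinearMap.range (homologyMap (K.monotone hsr.le) n) := by
    refine le_antisymm (iSup_le fun t => iSup₂_le fun hrt _ => (hgone t hrt).le) ?_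
    rw [← hgone r le_rfl]
    exact le_iSup_of_le r (le_iSup₂_of_le le_rfl (WithTop.coe_lt_top r) le_rfl)
  have hsub : goneBefore K n r ⊤ ≤ goneUpTo K n r ⊤ := le_top
  have key := finrank_quotient_comap_subtype_add_comap_mkQ
    ((boundaries (K r) n).comap (cycles (K r) n).subtype) hsub
  have hup : (goneUpTo K n r ⊤).comap
      ((boundaries (K r) n).comap (cycles (K r) n).subtype).mkQ = ⊤ := Submodule.comap_top _
  have hcyc : (goneBefore K n r ⊤).comap
      ((boundaries (K r) n).comap (cycles (K r) n).subtype).mkQ =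
      (cycles (K s) n).comap (cycles (K r) n).subtype := by
    rw [hbefore, comap_mkQ_range_homologyMap _ (hbd r)]
  rw [hup, hcyc, finrank_top, finrank_comap_subtype (cycles_mono (K.monotone hsr.le) n)] at key
  rw [persistenceDiagram, if_pos (WithTop.coe_lt_top r)]
  exact key

end Filtrations

/-! ### Counting edges in the Rips filtration -/

section Rips

variable {P : Type*} [Fintype P] {M : P → P → WithTop ℝ}

theorem boundaries_skeleton_self (K : PreAbstractSimplicialComplex P) (n : ℕ) :
    boundaries (skeleton K n) n = ⊥ := by
  rw [boundaries, show chains (skeleton K n) (n + 1) = ⊥ from ?_, Submodule.map_bot]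
  refine (Submodule.eq_bot_iff _).2 fun f hf => funext fun σ => ?_
  by_contra h
  obtain ⟨⟨_, h1⟩, h2⟩ := hf σ h
  omega

/-- The matrix has finitely many entries, so one `s` serves as the time just before `r`. -/
theorem exists_lt_forall_lt_imp_le (M : P → P → WithTop ℝ) {b r : ℝ} (hr : b < r) :
    ∃ s, b ≤ s ∧ s < r ∧ ∀ u v, M u v < (r : WithTop ℝ) → M u v ≤ (s : WithTop ℝ) := by
  have h : ∀ᶠ s : ℝ in nhdsWithin r (Set.Iio r),
      ∀ u v, M u v < (r : WithTop ℝ) → M u v ≤ (s : WithTop ℝ) := by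
    refine Filter.eventually_all.2 fun u => Filter.eventually_all.2 fun v => ?_
    by_cases huv : M u v < (r : WithTop ℝ)
    · obtain ⟨m, hm⟩ := WithTop.ne_top_iff_exists.1 huv.ne_top
      rw [← hm] at huv ⊢
      filter_upwards [Ico_mem_nhdsLT (WithTop.coe_lt_coe.1 huv)] with s hs _
      exact WithTop.coe_le_coe.2 hs.1
    · exact Filter.Eventually.of_forall fun s h => absurd h huv
  obtain ⟨s, hs, h1, h2⟩ := (h.and (Ico_mem_nhdsLT hr)).exists
  exact ⟨s, h1, h2, hs⟩

open Classical in
-- The map `(u, v) ↦ {u, v}` is two-to-one onto the 1-simplices.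
theorem two_mul_finrank_chains_one (hsymm : ∀ u v, M u v = M v u) (hdiag : ∀ u, M u u = 0)
    {ε : ℝ} (hε : 0 ≤ ε) :
    2 * finrank (ZMod 2) (chains (ripsFiltration M 1 ε) 1) =
      (Finset.univ.filter fun p : P × P => p.1 ≠ p.2 ∧ M p.1 p.2 ≤ (ε : WithTop ℝ)).card := by
  have hε' : (0 : WithTop ℝ) ≤ (ε : WithTop ℝ) := WithTop.coe_le_coe.2 hε
  rw [finrank_chains, Nat.card_eq_fintype_card, Fintype.card_subtype]
  symm
  rw [Finset.card_eq_sum_card_fiberwise (f := fun p : P × P => ({p.1, p.2} : Finset P))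
    (t := Finset.univ.filter fun σ => σ ∈ (ripsFiltration M 1 ε).faces ∧ σ.card = 1 + 1)]
  · rw [Finset.sum_const_nat (m := 2), mul_comm]
    intro σ hσ
    obtain ⟨-, ⟨⟨-, hM⟩, -⟩, hc⟩ := Finset.mem_filter.1 hσ
    obtain ⟨a, b, hab, rfl⟩ := Finset.card_eq_two.1 hc
    have hMab := hM a (by simp) b (by simp)
    rw [← Finset.card_pair (a := (a, b)) (b := (b, a)) (by simp [hab])]
    congr 1
    ext ⟨u, v⟩
    simp only [Finset.mem_filter, Finset.mem_univ, true_and, Finset.mem_insert,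
      Finset.mem_singleton, Prod.mk.injEq]
    constructor
    · rintro ⟨⟨huv, -⟩, h⟩
      have hu : u ∈ ({a, b} : Finset P) := h ▸ by simp
      have hv : v ∈ ({a, b} : Finset P) := h ▸ by simp
      simp only [Finset.mem_insert, Finset.mem_singleton] at hu hv
      grind
    · rintro (⟨rfl, rfl⟩ | ⟨rfl, rfl⟩)
      · exact ⟨⟨hab, hMab⟩, rfl⟩
      · exact ⟨⟨hab.symm, hsymm u v ▸ hMab⟩, Finset.pair_comm _ _⟩
  · rintro ⟨u, v⟩ h
    simp only [Finset.coe_filter, Finset.mem_univ, true_and, Set.mem_ofPred_eq] at h ⊢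
    have hc := Finset.card_pair h.1
    refine ⟨⟨⟨⟨u, by simp⟩, ?_⟩, hc.le⟩, hc⟩
    intro x hx y hy
    simp only [Finset.mem_insert, Finset.mem_singleton] at hx hy
    rcases hx with rfl | rfl <;> rcases hy with rfl | rfl
    · rwa [hdiag]
    · exact h.2
    · rw [hsymm]; exact h.2
    · rwa [hdiag]

open Classical in
/-- Every edge of length `r` either kills a component or creates a cycle. -/
theorem two_mul_persistenceDiagram_add_persistenceDiagram (hsymm : ∀ u v, M u v = M v u)
    (hdiag : ∀ u, M u u = 0) {r : ℝ} (hr : 0 < r) :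
    2 * (persistenceDiagram (ripsFiltration M 1) 0 (0, (r : WithTop ℝ)) +
      persistenceDiagram (ripsFiltration M 1) 1 (r, ⊤)) =
      (Finset.univ.filter fun p : P × P => p.1 ≠ p.2 ∧ M p.1 p.2 = (r : WithTop ℝ)).card := by
  obtain ⟨s, h0s, hsr, hs⟩ := exists_lt_forall_lt_imp_le M hr
  have hK : ∀ t < r, ripsFiltration M 1 t ≤ ripsFiltration M 1 s := by
    intro t ht σ hσ
    exact ⟨⟨hσ.1.1, fun u hu v hv =>
      hs u v ((hσ.1.2 u hu v hv).trans_lt (WithTop.coe_lt_coe.2 ht))⟩, hσ.2⟩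
  have hempty : ∀ t < (0 : ℝ), (ripsFiltration M 1 t).faces = ∅ := by
    intro t ht
    refine Set.eq_empty_iff_forall_notMem.2 fun σ hσ => ?_
    obtain ⟨u, hu⟩ := hσ.1.1
    have := hσ.1.2 u hu u hu
    rw [hdiag, ← WithTop.coe_zero, WithTop.coe_le_coe] at this
    exact absurd ht this.not_gt
  have hvert : chains (ripsFiltration M 1 r) 0 ≤ chains (ripsFiltration M 1 0) 0 := by
    intro f hf σ hσ
    obtain ⟨h1, h2⟩ := hf σ hσ
    obtain ⟨a, rfl⟩ := Finset.card_eq_one.1 h2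
    refine ⟨⟨⟨h1.1.1, ?_⟩, h1.2⟩, h2⟩
    intro u hu v hv
    rw [Finset.mem_singleton] at hu hv
    rw [hu, hv, hdiag, WithTop.coe_zero]
  have e0 := persistenceDiagram_zero_add (ripsFiltration M 1) h0s hsr hK hempty hvert
  have e1 := persistenceDiagram_top_add (ripsFiltration M 1) hsr hK
    (fun t => boundaries_skeleton_self (vietorisRips M t) 1)
  have n0 := finrank_boundaries_add_finrank_cycles (ripsFiltration M 1 s) 0
  have n1 := finrank_boundaries_add_finrank_cycles (ripsFiltration M 1 r) 0
  have c0 := two_mul_finrank_chains_one hsymm hdiag h0s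
  have c1 := two_mul_finrank_chains_one hsymm hdiag hr.le
  have hsplit : (Finset.univ.filter fun p : P × P => p.1 ≠ p.2 ∧ M p.1 p.2 ≤ (r : WithTop ℝ)).card =
      (Finset.univ.filter fun p : P × P => p.1 ≠ p.2 ∧ M p.1 p.2 = (r : WithTop ℝ)).card +
      (Finset.univ.filter fun p : P × P => p.1 ≠ p.2 ∧ M p.1 p.2 ≤ (s : WithTop ℝ)).card := by
    rw [← Finset.card_union_of_disjoint]
    · congr 1
      ext ⟨u, v⟩
      simp only [Finset.mem_filter, Finset.mem_univ, true_and, Finset.mem_union, ← and_or_left]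
      refine and_congr_right fun _ => ⟨fun h => ?_, ?_⟩
      · exact h.eq_or_lt.imp id (hs u v)
      · rintro (h | h)
        · exact h.le
        · exact h.trans (WithTop.coe_le_coe.2 hsr.le)
    · rw [Finset.disjoint_filter]
      rintro p - ⟨-, h⟩ ⟨-, h'⟩
      rw [h, WithTop.coe_le_coe] at h'
      exact absurd hsr h'.not_gt
  simp only [Nat.reduceAdd] at n0 n1
  -- Rank-nullity at `r` minus rank-nullity at `s`: the growth of 0-boundaries plus that of 1-cycles
  -- is the growth of 1-chains.
  omega

end Rips

/-! ### Colored edges and degree counting -/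

section Graphs

variable {ι : Type*} {V : ι → Type*} {χ : Type*}
  {𝒢 : ∀ i, SimpleGraph (V i)} {C : ∀ i, V i → χ}

theorem distMatrix_self (ef : EdgeFiltration 𝒢 C) (i : ι) (u : V i) : distMatrix ef i u u = 0 := by
  simp [distMatrix]

theorem distMatrix_comm (ef : EdgeFiltration 𝒢 C) (i : ι) (u v : V i) :
    distMatrix ef i u v = distMatrix ef i v u := by
  by_cases huv : u = v
  · rw [huv]
  by_cases h : (𝒢 i).Adj u v
  · simp [distMatrix, huv, Ne.symm huv, h, h.symm, Sym2.eq_swap (a := C i u)]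
  · simp [distMatrix, huv, Ne.symm huv, h, (𝒢 i).adj_comm v u]

/-- A finite off-diagonal entry forces adjacency, and injectivity recovers the edge color from its
length. -/
theorem ne_and_distMatrix_eq_iff (ef : EdgeFiltration 𝒢 C) (hef : Function.Injective ef.toFun)
    (i : ι) (c : coloredEdges 𝒢 C) (u v : V i) :
    u ≠ v ∧ distMatrix ef i u v = (ef.toFun c : WithTop ℝ) ↔
      (𝒢 i).Adj u v ∧ s(C i u, C i v) = c := by
  by_cases h : (𝒢 i).Adj u v
  · simp [distMatrix, h, h.ne, WithTop.coe_inj, hef.eq_iff, Subtype.ext_iff]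
  · simp +contextual [distMatrix, h]

variable [∀ i, Fintype (V i)]

open Classical in
/-- The pairs of adjacent nodes. -/
noncomputable def adjPairs (𝒢 : ∀ i, SimpleGraph (V i)) (i : ι) : Finset (V i × V i) :=
  Finset.univ.filter fun p => (𝒢 i).Adj p.1 p.2

/-- The colored edges of the pairs of adjacent nodes, with multiplicity. -/
noncomputable def pairColors (𝒢 : ∀ i, SimpleGraph (V i)) (C : ∀ i, V i → χ) (i : ι) :
    Multiset (Sym2 χ) :=
  (adjPairs 𝒢 i).val.map fun p => s(C i p.1, C i p.2)

open Classical in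
theorem count_pairColors (i : ι) (c : Sym2 χ) :
    (pairColors 𝒢 C i).count c =
      (Finset.univ.filter fun p : V i × V i =>
        (𝒢 i).Adj p.1 p.2 ∧ s(C i p.1, C i p.2) = c).card := by
  rw [pairColors, Multiset.count_map, adjPairs, ← Finset.filter_val, Finset.card_val,
    Finset.filter_filter]
  simp only [eq_comm]

theorem pairColors_eq_of_ted_eq (ef : EdgeFiltration 𝒢 C) (hef : Function.Injective ef.toFun)
    {G H : ι} (h : ted ef G = ted ef H) : pairColors 𝒢 C G = pairColors 𝒢 C H := by
  classical
  ext c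
  by_cases hc : c ∈ coloredEdges 𝒢 C
  · have key : ∀ i, (pairColors 𝒢 C i).count c =
        2 * ((ted ef i).1 (0, (ef.toFun ⟨c, hc⟩ : WithTop ℝ)) +
          (ted ef i).2 (ef.toFun ⟨c, hc⟩, ⊤)) := by
      intro i
      rw [count_pairColors]
      refine Eq.trans ?_ (two_mul_persistenceDiagram_add_persistenceDiagram
        (distMatrix_comm ef i) (distMatrix_self ef i) (ef.pos ⟨c, hc⟩)).symm
      simp only [ne_and_distMatrix_eq_iff ef hef i ⟨c, hc⟩]
    rw [key, key, h]
  · have key : ∀ i, (pairColors 𝒢 C i).count c = 0 := by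
      intro i
      rw [count_pairColors, Finset.card_eq_zero, Finset.filter_eq_empty_iff]
      rintro p - ⟨hp, rfl⟩
      exact hc (mem_coloredEdges C hp)
    rw [key, key]

open Classical in
/-- The degree sum over the nodes of color `a`, computed from the colored edges. -/
theorem two_mul_sum_ncard_neighborSet (i : ι) (a : χ) :
    2 * ∑ u with C i u = a, ((𝒢 i).neighborSet u).ncard =
      ((pairColors 𝒢 C i).map fun c => c.toMultiset.count a).sum := by
  have hfst : ∑ u with C i u = a, ((𝒢 i).neighborSet u).ncard =
      ∑ p ∈ adjPairs 𝒢 i, if C i p.1 = a then 1 else 0 := by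
    rw [adjPairs, Finset.sum_filter, Finset.sum_filter, Fintype.sum_prod_type]
    refine Finset.sum_congr rfl fun u _ => ?_
    by_cases hu : C i u = a
    · simp [hu, Set.ncard_eq_toFinset_card']
    · simp [hu]
  -- By symmetry one copy of the degree sum can count second endpoints. Both copies together give
  -- the multiplicity of `a` in each color pair, which is 2 if both ends have color `a`.
  have hsnd : ∑ p ∈ adjPairs 𝒢 i, (if C i p.1 = a then 1 else 0) =
      ∑ p ∈ adjPairs 𝒢 i, if C i p.2 = a then 1 else 0 := by
    refine Finset.sum_equiv (Equiv.prodComm _ _) (fun p => ?_) (fun p _ => rfl)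
    simp [adjPairs, (𝒢 i).adj_comm p.1]
  rw [two_mul, hfst]
  nth_rw 2 [hsnd]
  rw [← Finset.sum_add_distrib, pairColors, Multiset.map_map, Finset.sum]
  congr 1
  refine Multiset.map_congr rfl fun p _ => ?_
  simp [Sym2.toMultiset, List.count_cons, add_comm]

theorem colorMultiset_eq_of_pairColors_eq (hdeg : DegreeAssumption 𝒢 C) {G H : ι}
    (hG : ∀ u : V G, ¬ (𝒢 G).IsIsolated u) (hH : ∀ v : V H, ¬ (𝒢 H).IsIsolated v)
    (h : pairColors 𝒢 C G = pairColors 𝒢 C H) : colorMultiset C G = colorMultiset C H := by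
  classical
  ext a
  have hcount : ∀ i, (colorMultiset C i).count a = (Finset.univ.filter fun u => C i u = a).card := by
    intro i
    rw [colorMultiset, Multiset.count_map, ← Finset.filter_val, Finset.card_val]
    simp only [eq_comm]
  have hpos : ∀ i, ∀ u : V i, ¬ (𝒢 i).IsIsolated u → 0 < ((𝒢 i).neighborSet u).ncard := by
    intro i u hu
    rw [Set.ncard_pos]
    by_contra hne
    refine hu fun v hv => hne ⟨v, hv⟩
  have hsum : ∀ d, (∀ i u, C i u = a → ((𝒢 i).neighborSet u).ncard = d) → ∀ i,
      2 * ((colorMultiset C i).count a * d) =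
      ((pairColors 𝒢 C i).map fun c => c.toMultiset.count a).sum := by
    intro d hd i
    rw [← two_mul_sum_ncard_neighborSet, hcount,
      Finset.sum_const_nat fun u hu => hd i u (Finset.mem_filter.1 hu).2]
  -- One node `w` of color `a` fixes the common degree for both graphs, even if the other graph has
  -- no such node.
  have main : ∀ i (w : V i), C i w = a → ¬ (𝒢 i).IsIsolated w →
      (colorMultiset C G).count a = (colorMultiset C H).count a := by
    intro i w hw hiso
    have hd := hsum _ fun j u hu => hdeg j i u w (hu.trans hw.symm)
    have := hd G
    rw [h, ← hd H] at this
    exact Nat.eq_of_mul_eq_mul_right (hpos i w hiso) (Nat.eq_of_mul_eq_mul_left two_pos this)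
  by_cases hg : ∃ w, C G w = a
  · obtain ⟨w, hw⟩ := hg
    exact main G w hw (hG w)
  by_cases hh : ∃ w, C H w = a
  · obtain ⟨w, hw⟩ := hh
    exact main H w hw (hH w)
  push Not at hg hh
  rw [hcount, hcount, Finset.filter_false_of_mem fun u _ => hg u,
    Finset.filter_false_of_mem fun u _ => hh u]
  rfl

end Graphs

end TED

theorem lemma4p1 {ι : Type*} {V : ι → Type*} [∀ i, Fintype (V i)] {χ : Type*}
    (𝒢 : ∀ i, SimpleGraph (V i)) (C : ∀ i, V i → χ)
    (hdeg : TED.DegreeAssumption 𝒢 C)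
    (G H : ι)
    (hG : ∀ u : V G, ¬ (𝒢 G).IsIsolated u)
    (hH : ∀ v : V H, ¬ (𝒢 H).IsIsolated v)
    (hcol : TED.colorMultiset C G ≠ TED.colorMultiset C H)
    (ef : TED.EdgeFiltration 𝒢 C) (hef : Function.Injective ef.toFun) :
    TED.ted ef G ≠ TED.ted ef H :=
  fun h => hcol (TED.colorMultiset_eq_of_pairColors_eq hdeg hG hH
    (TED.pairColors_eq_of_ted_eq ef hef h))
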